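/- Let $A$ be a subset of a finite Abelian group $G$. Call $A$ sum-free if there are no $x,y,z\in A$ (not necessarily distinct) with $x+y=z$. For $B\subseteq G$ let $\mathrm{SF}(B)$ be the collection of sum-free subsets of $B$ of maximum size, and call $B$ sum-free good if every member of $\mathrm{SF}(B)$ is of the form $A\cap B$ for some $A\in\mathrm{SF}(G)$. For $p \in [0,1]$, let $G_p$ denote the $p$-random subset of $G$, in which each element of $G$ is included with probability $p$, independently of all other elements. Let $q$ range over the primes with $q\equiv 1\pmod 3$, let $n=3q$, and let $G=\mathbb{Z}_n$. Suppose that $p=p(n)\in[0,1]$ satisfies $$\frac{\log n}{n}\;\ll\; p(n)\;\ll\;\left(\frac{1}{n\log n}\right)^{1/3}$$ as $n\to\infty$ along such $n$, where $f\ll g$ means $f=o(g)$. Then, with probability tending to $1$ as $n\to\infty$ along such $n$, there exists a sum-free subset of $G_p$ which has more elements than $A\cap G_p$ for every $A\in\mathrm{SF}(G)$; in particular, with probability tending to $1$, $G_p$ is not sum-free good. -/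

import Mathlib

open Filter Topology Asymptotics ProbabilityTheory

/-- A subset `A` of an Abelian group is sum-free if there is no solution to `x + y = z` with
`x, y, z ∈ A` (coincidences among `x, y, z` are allowed in the forbidden solutions). -/
def IsSumFree {G : Type*} [AddCommGroup G] (A : Set G) : Prop :=
  ∀ x ∈ A, ∀ y ∈ A, x + y ∉ A

/-- `SF B` is the collection of maximum-size sum-free subsets of `B`. -/
def SF {G : Type*} [AddCommGroup G] (B : Set G) : Set (Set G) :=
  {A | (A ⊆ B ∧ IsSumFree A) ∧ ∀ A' : Set G, A' ⊆ B → IsSumFree A' → A'.encard ≤ A.encard}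

/-- `B ⊆ G` is sum-free good if every maximum-size sum-free subset of `B` is of the form `B ∩ A`
for some maximum-size sum-free subset `A` of `G`. -/
def IsSumFreeGood {G : Type*} [AddCommGroup G] (B : Set G) : Prop :=
  ∀ S ∈ SF B, ∃ A ∈ SF (Set.univ : Set G), S = B ∩ A

/-- The filter `n → ∞` along the integers `n = 3q` with `q` a prime, `q ≡ 1 (mod 3)`. -/
def threePrimeAtTop : Filter ℕ :=
  atTop ⊓ 𝓟 {n : ℕ | ∃ q : ℕ, q.Prime ∧ q ≡ 1 [MOD 3] ∧ n = 3 * q}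

/-- The law of the `p`-random subset of `ZMod n`: every element is included with probability `p`,
independently of all the others. -/
noncomputable def randomSubset (n : ℕ) (p : unitInterval) : MeasureTheory.Measure (Set (ZMod n)) :=
  setBernoulli (Set.univ : Set (ZMod n)) p

/-!
The middle interval `[q, 2 q)` is one of the largest sum-free subsets of `ZMod (3 * q)`. Lengthened
by `a` residues it gains about `a p` random elements, at the price of about `a² p³` sums within the
random set, one element of each of which has to be removed. The largest sum-free sets have `q`
elements and there are only polynomially many of them, so none of them deviates from `p q` by more
than a constant times `√(p q log n)`. The choice `a p ≈ C √(p q log n)` is feasible (`a < q / 2`)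
because `p n` is much larger than `log n`, and then `a² p³` is much smaller than `a p` because
`p ^ 3 n log n` tends to `0`.

The polynomial count of largest sum-free sets is `ncard_SF_univ_le`. The slices of such a set over
the residues modulo `3` are subsets of `ZMod q`, with `q = 3 k + 1`, to which the Cauchy–Davenport
theorem applies: either one slice is everything, or one slice `P` has `k + 1` elements and
`|P + P| = 2 |P| - 1`, and the two others are the complements of `P + P` and of `P - P`. A case of
Vosper's theorem, `eq_image_range_of_card_add_self_le`, makes `P` an arithmetic progression, which
leaves at most `q²` possibilities. It is proved by the isoperimetric method: a minimal fragment
(`IsFragment`) meets its translates in at most one element.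

The probabilistic estimates are the two Chernoff bounds `setBernoulli_upper_tail` and
`setBernoulli_lower_tail` and the first moment bound `setBernoulli_card_subset_ge_le`.
-/

/-! ### The random subset of a finite type -/

section RandomSubset

variable {ι : Type*} [Fintype ι] [DecidableEq ι]

/-- The probability that the `p`-random subset of `ι` is equal to `T`. -/
noncomputable def subsetWeight (p : ℝ) (T : Finset ι) : ℝ :=
  p ^ T.card * (1 - p) ^ (Finset.univ \ T).card

lemma subsetWeight_nonneg {p : ℝ} (h0 : 0 ≤ p) (h1 : p ≤ 1) (T : Finset ι) :
    0 ≤ subsetWeight p T :=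
  mul_nonneg (pow_nonneg h0 _) (pow_nonneg (sub_nonneg.2 h1) _)

lemma setBernoulli_real_singleton_coe (p : unitInterval) (T : Finset ι) :
    (setBernoulli (Set.univ : Set ι) p).real {(T : Set ι)} = subsetWeight (p : ℝ) T := by
  rw [setBernoulli_real_singleton p (Set.subset_univ _) Set.finite_univ, subsetWeight]
  congr 2
  · exact Set.ncard_coe_finset T
  · rw [← Finset.coe_univ, ← Finset.coe_sdiff, Set.ncard_coe_finset]

/-- Markov's inequality for the random subset, in the form of a finite sum. -/
lemma setBernoulli_real_le_sum (p : unitInterval) (E : Set (Set ι)) (F : Finset ι → ℝ)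
    (hF : ∀ T, 0 ≤ F T) (hE : ∀ T : Finset ι, (T : Set ι) ∈ E → 1 ≤ F T) :
    (setBernoulli (Set.univ : Set ι) p).real E ≤ ∑ T, subsetWeight (p : ℝ) T * F T := by
  classical
  set s : Finset (Finset ι) := Finset.univ.filter fun T => (T : Set ι) ∈ E with hs
  have hcover : E ⊆ ⋃ T ∈ s, {(T : Set ι)} := by
    intro B hB
    simp only [Set.mem_iUnion]
    refine ⟨B.toFinset, ?_, by simp⟩
    simp [hs, hB]
  calc (setBernoulli (Set.univ : Set ι) p).real E
      ≤ (setBernoulli (Set.univ : Set ι) p).real (⋃ T ∈ s, {(T : Set ι)}) :=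
        MeasureTheory.measureReal_mono hcover (MeasureTheory.measure_ne_top _ _)
    _ ≤ ∑ T ∈ s, (setBernoulli (Set.univ : Set ι) p).real {(T : Set ι)} :=
        MeasureTheory.measureReal_biUnion_finset_le _ _
    _ = ∑ T ∈ s, subsetWeight (p : ℝ) T :=
        Finset.sum_congr rfl fun T _ => setBernoulli_real_singleton_coe p T
    _ ≤ ∑ T ∈ s, subsetWeight (p : ℝ) T * F T := by
        refine Finset.sum_le_sum fun T hT => le_mul_of_one_le_right
          (subsetWeight_nonneg p.2.1 p.2.2 T) (hE T ?_)
        simpa [hs] using hT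
    _ ≤ ∑ T, subsetWeight (p : ℝ) T * F T :=
        Finset.sum_le_sum_of_subset_of_nonneg (Finset.subset_univ _) fun T _ _ =>
          mul_nonneg (subsetWeight_nonneg p.2.1 p.2.2 T) (hF T)

/-- Independence of the membership events: the expectation of a product over all `i` of a factor
`f i` if `i` is selected and `g i` otherwise. -/
lemma sum_subsetWeight_mul_prod (p : ℝ) (f g : ι → ℝ) :
    ∑ T, subsetWeight p T * ((∏ i ∈ T, f i) * ∏ i ∈ Finset.univ \ T, g i) =
      ∏ i, (p * f i + (1 - p) * g i) := by
  rw [Finset.prod_add, Finset.powerset_univ]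
  refine Finset.sum_congr rfl fun T _ => ?_
  rw [Finset.prod_mul_distrib, Finset.prod_mul_distrib, Finset.prod_const, Finset.prod_const,
    subsetWeight]
  ring

lemma sum_subsetWeight_subset (p : ℝ) (K : Finset ι) :
    ∑ T, subsetWeight p T * (if K ⊆ T then 1 else 0) = p ^ K.card := by
  have h := sum_subsetWeight_mul_prod p (fun _ => 1) (fun i => if i ∈ K then 0 else 1)
  have h2 : ∏ i, (p * 1 + (1 - p) * (if i ∈ K then (0 : ℝ) else 1)) = p ^ K.card := by
    rw [← Finset.prod_const, ← Finset.prod_filter_mul_prod_filter_not Finset.univ (· ∈ K)]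
    rw [Finset.filter_mem_eq_inter, Finset.univ_inter]
    rw [Finset.prod_congr rfl (g := fun _ => p), Finset.prod_eq_one (s := Finset.univ.filter _),
      mul_one]
    · intro i hi
      simp only [Finset.mem_filter] at hi
      simp [hi.2]
    · intro i hi
      simp [hi]
  rw [← h2, ← h]
  refine Finset.sum_congr rfl fun T _ => ?_
  congr 1
  rw [Finset.prod_const_one, one_mul]
  split_ifs with hK
  · symm
    refine Finset.prod_eq_one fun i hi => ?_
    rw [if_neg fun hiK => (Finset.mem_sdiff.1 hi).2 (hK hiK)]
  · obtain ⟨i, hiK, hiT⟩ := Finset.not_subset.1 hK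
    symm
    exact Finset.prod_eq_zero (i := i) (by simp [hiT]) (by simp [hiK])

/-- The moment generating function of the size of the part of a random set inside `A`. -/
lemma sum_subsetWeight_exp_le {p : ℝ} (h0 : 0 ≤ p) (h1 : p ≤ 1) (A : Finset ι) {l : ℝ}
    (hl : |l| ≤ 1) :
    ∑ T, subsetWeight p T * Real.exp (l * (A ∩ T).card) ≤
      Real.exp (p * A.card * (l + l ^ 2)) := by
  have h := sum_subsetWeight_mul_prod p (fun i => if i ∈ A then Real.exp l else 1) (fun _ => 1)
  have hT : ∀ T : Finset ι, (∏ i ∈ T, if i ∈ A then Real.exp l else 1) =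
      Real.exp (l * (A ∩ T).card) := by
    intro T
    rw [← Finset.prod_filter, Finset.prod_const, Finset.filter_mem_eq_inter, Finset.inter_comm,
      ← Real.exp_nat_mul, mul_comm]
  simp only [hT, Finset.prod_const_one, mul_one] at h
  rw [h]
  have hexp : Real.exp l - 1 ≤ l + l ^ 2 := by
    have := (abs_le.1 (Real.abs_exp_sub_one_sub_id_le hl)).2
    linarith
  have hfac : ∀ i ∈ (Finset.univ : Finset ι), p * (if i ∈ A then Real.exp l else 1) + (1 - p) ≤
      if i ∈ A then Real.exp (p * (l + l ^ 2)) else 1 := by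
    intro i _
    split_ifs
    · have := Real.add_one_le_exp (p * (l + l ^ 2))
      nlinarith
    · linarith
  refine (Finset.prod_le_prod (fun i _ => ?_) hfac).trans ?_
  · have : 0 ≤ (if i ∈ A then Real.exp l else 1) := by split_ifs <;> positivity
    nlinarith [mul_nonneg h0 this]
  · rw [← Finset.prod_filter, Finset.prod_const, Finset.filter_mem_eq_inter, Finset.univ_inter,
      ← Real.exp_nat_mul]
    apply le_of_eq
    congr 1
    ring

/-- Chernoff's bound for the upper tail. -/
lemma setBernoulli_upper_tail (p : unitInterval) (A : Finset ι) {m t : ℝ} (hA : A.card ≤ m)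
    (ht0 : 0 ≤ t) (hpm : 0 < p * m) (ht : t ≤ 2 * (p * m)) :
    (setBernoulli (Set.univ : Set ι) p).real
        {B | p * m + t ≤ ((A : Set ι) ∩ B).ncard} ≤ Real.exp (-(t ^ 2 / (4 * (p * m)))) := by
  classical
  set l : ℝ := t / (2 * (p * m)) with hl
  have hl0 : 0 ≤ l := by positivity
  have hl1 : |l| ≤ 1 := by rw [abs_of_nonneg hl0]; exact (div_le_one (by positivity)).2 ht
  refine (setBernoulli_real_le_sum p _
    (fun T => Real.exp (l * (A ∩ T).card) * Real.exp (-(l * (p * m + t))))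
    (fun T => by positivity) ?_).trans ?_
  · intro T hT
    rw [Set.mem_ofPred_eq, ← Finset.coe_inter, Set.ncard_coe_finset] at hT
    rw [← Real.exp_add]
    apply Real.one_le_exp
    nlinarith [mul_le_mul_of_nonneg_left hT hl0]
  · rw [Finset.sum_congr rfl fun T _ => (mul_assoc _ _ _).symm, ← Finset.sum_mul]
    refine (mul_le_mul_of_nonneg_right (sum_subsetWeight_exp_le p.2.1 p.2.2 A hl1)
      (Real.exp_nonneg _)).trans ?_
    rw [← Real.exp_add]
    apply Real.exp_le_exp.2
    have h1 : (p : ℝ) * A.card * (l + l ^ 2) ≤ p * m * (l + l ^ 2) := by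
      have := p.2.1
      gcongr
    have h2 : l * t = 2 * (p * m * l ^ 2) := by rw [hl]; field_simp
    have h3 : t ^ 2 / (4 * (p * m)) = p * m * l ^ 2 := by rw [hl]; field_simp; ring
    rw [h3]
    have h5 : p * m * (l + l ^ 2) + -(l * (p * m + t)) = p * m * l ^ 2 - l * t := by ring
    linarith

/-- Chernoff's bound for the lower tail. -/
lemma setBernoulli_lower_tail (p : unitInterval) (A : Finset ι) {t : ℝ}
    (ht0 : 0 ≤ t) (hpm : 0 < p * (A.card : ℝ)) (ht : t ≤ 2 * (p * A.card)) :
    (setBernoulli (Set.univ : Set ι) p).real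
        {B | (((A : Set ι) ∩ B).ncard : ℝ) ≤ p * A.card - t} ≤
      Real.exp (-(t ^ 2 / (4 * (p * A.card)))) := by
  classical
  set m : ℝ := (A.card : ℝ)
  set l : ℝ := t / (2 * (p * m)) with hl
  have hl0 : 0 ≤ l := by positivity
  have hl1 : |-l| ≤ 1 := by
    rw [abs_neg, abs_of_nonneg hl0]; exact (div_le_one (by positivity)).2 ht
  refine (setBernoulli_real_le_sum p _
    (fun T => Real.exp (-l * (A ∩ T).card) * Real.exp (l * (p * m - t)))
    (fun T => by positivity) ?_).trans ?_
  · intro T hT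
    rw [Set.mem_ofPred_eq, ← Finset.coe_inter, Set.ncard_coe_finset] at hT
    rw [← Real.exp_add]
    apply Real.one_le_exp
    nlinarith [mul_le_mul_of_nonneg_left hT hl0]
  · rw [Finset.sum_congr rfl fun T _ => (mul_assoc _ _ _).symm, ← Finset.sum_mul]
    refine (mul_le_mul_of_nonneg_right (sum_subsetWeight_exp_le p.2.1 p.2.2 A hl1)
      (Real.exp_nonneg _)).trans ?_
    rw [← Real.exp_add]
    apply Real.exp_le_exp.2
    have h0 : (A.card : ℝ) = m := rfl
    have h2 : l * t = 2 * (p * m * l ^ 2) := by rw [hl]; field_simp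
    have h3 : t ^ 2 / (4 * (p * m)) = p * m * l ^ 2 := by rw [hl]; field_simp; ring
    rw [h3, h0]
    have h5 : p * m * (-l + (-l) ^ 2) + l * (p * m - t) = p * m * l ^ 2 - l * t := by ring
    linarith

/-- The first moment bound for the number of members of a family `K` of sets that are contained
in the random set. -/
lemma setBernoulli_card_subset_ge_le {κ : Type*} (p : unitInterval) (P : Finset κ)
    (K : κ → Finset ι) {c : ℝ} (hc : 0 < c) :
    (setBernoulli (Set.univ : Set ι) p).real
        {B | c ≤ ({x ∈ (P : Set κ) | (K x : Set ι) ⊆ B}.ncard : ℝ)} ≤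
      (∑ x ∈ P, (p : ℝ) ^ (K x).card) / c := by
  classical
  refine (setBernoulli_real_le_sum p _
    (fun T => (∑ x ∈ P, if K x ⊆ T then (1 : ℝ) else 0) / c) (fun T => ?_) ?_).trans ?_
  · exact div_nonneg (Finset.sum_nonneg fun x _ => by split_ifs <;> norm_num) hc.le
  · intro T hT
    have : {x ∈ (P : Set κ) | (K x : Set ι) ⊆ T} = (P.filter fun x => K x ⊆ T : Finset κ) := by
      ext x; simp
    rw [Set.mem_ofPred_eq, this, Set.ncard_coe_finset] at hT
    rw [le_div_iff₀ hc, one_mul, Finset.sum_boole]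
    exact hT
  · apply le_of_eq
    simp only [← mul_div_assoc]
    rw [← Finset.sum_div]
    congr 1
    simp only [Finset.mul_sum]
    rw [Finset.sum_comm]
    exact Finset.sum_congr rfl fun x _ => sum_subsetWeight_subset _ _

end RandomSubset

/-! ### Critical pairs in `ZMod q` -/

section CriticalPairs

open scoped Pointwise

variable {q : ℕ} [Fact q.Prime]

/-- `F` attains the Cauchy–Davenport bound when it is added to `S`, and does so non-trivially:
`F` has at least two elements and `F + S` misses at least two residues. -/
def IsFragment (S F : Finset (ZMod q)) : Prop :=
  2 ≤ F.card ∧ (F + S).card + 1 ≤ F.card + S.card ∧ (F + S).card + 2 ≤ q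

lemma ZMod.injOn_natCast_mul {d : ZMod q} (hd : d ≠ 0) :
    Set.InjOn (fun j : ℕ => (j : ZMod q) * d) {j | j < q} := by
  intro i hi j hj hij
  have h := mul_right_cancel₀ hd hij
  rw [ZMod.natCast_eq_natCast_iff'] at h
  rwa [Nat.mod_eq_of_lt hi, Nat.mod_eq_of_lt hj] at h

lemma ZMod.eq_univ_of_vadd_eq {F : Finset (ZMod q)} (hF : F.Nonempty) {g : ZMod q} (hg : g ≠ 0)
    (h : g +ᵥ F = F) : F = Finset.univ := by
  obtain ⟨x, hx⟩ := hF
  have key : ∀ j : ℕ, x + j * g ∈ F := by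
    intro j
    induction j with
    | zero => simpa using hx
    | succ j ih =>
      rw [← h]
      refine Finset.mem_vadd_finset.2 ⟨_, ih, ?_⟩
      push_cast
      rw [vadd_eq_add]
      ring
  refine Finset.eq_univ_iff_forall.2 fun y => ?_
  have h2 := key ((y - x) / g).val
  rw [ZMod.natCast_val, ZMod.cast_id, div_mul_cancel₀ _ hg] at h2
  simpa using h2

/-- A fragment of minimal size meets each of its proper translates in at most one element, because
the sets `(F ∩ (g + F)) + S` and `(F ∪ (g + F)) + S` have together at most `2 |F + S|` elements.
The condition on the sizes keeps the union within the range of the Cauchy–Davenport bound. -/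
lemma exists_isFragment_card_inter_vadd_le_one {S : Finset (ZMod q)} (hS : S.Nonempty) :
    ∀ (m : ℕ) (F : Finset (ZMod q)), F.card = m → IsFragment S F → 2 * F.card + S.card ≤ q + 3 →
      ∃ M, M.card ≤ F.card ∧ IsFragment S M ∧ ∀ g : ZMod q, g ≠ 0 → (M ∩ (g +ᵥ M)).card ≤ 1 := by
  intro m
  induction m using Nat.strong_induction_on with
  | _ m ih =>
    intro F hFm hF hq
    by_cases hall : ∀ g : ZMod q, g ≠ 0 → (F ∩ (g +ᵥ F)).card ≤ 1
    · exact ⟨F, le_rfl, hF, hall⟩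
    push Not at hall
    obtain ⟨g, hg, hI⟩ := hall
    obtain ⟨h2, hc, hc'⟩ := hF
    have hFne : F.Nonempty := Finset.card_pos.1 (by omega)
    have hprop : (F ∩ (g +ᵥ F)).card < F.card := by
      refine Finset.card_lt_card ((Finset.ssubset_iff_subset_ne).2 ⟨Finset.inter_subset_left, ?_⟩)
      intro heq
      have hsub : F ⊆ g +ᵥ F := Finset.inter_eq_left.1 heq
      have heq' := Finset.eq_of_subset_of_card_le hsub (by rw [Finset.card_vadd_finset])
      have huniv := ZMod.eq_univ_of_vadd_eq hFne hg heq'.symm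
      have h1 : F.card ≤ (F + S).card := Finset.card_le_card_add_right hS
      rw [huniv, Finset.card_univ, ZMod.card] at h1
      rw [huniv] at hc'
      omega
    have hunion := Finset.card_union_add_card_inter F (g +ᵥ F)
    rw [Finset.card_vadd_finset] at hunion
    have hsum := Finset.card_union_add_card_inter (F + S) ((g +ᵥ F) + S)
    have htr : ((g +ᵥ F) + S).card = (F + S).card := by
      rw [vadd_add_assoc, Finset.card_vadd_finset]
    rw [← Finset.union_add, htr] at hsum
    have hinter : (F ∩ (g +ᵥ F) + S).card ≤ ((F + S) ∩ ((g +ᵥ F) + S)).card :=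
      Finset.card_le_card Finset.inter_add_subset
    have hcd := ZMod.cauchy_davenport (Fact.out : q.Prime)
      (hFne.mono (Finset.subset_union_left (s₂ := g +ᵥ F))) hS
    have hle : ((F ∩ (g +ᵥ F)) + S).card ≤ (F + S).card :=
      Finset.card_le_card (Finset.add_subset_add_right Finset.inter_subset_left)
    rw [min_le_iff] at hcd
    obtain ⟨M, hM, hM'⟩ := ih _ (hFm ▸ hprop) (F ∩ (g +ᵥ F)) rfl
      ⟨hI, by omega, by omega⟩ (by omega)
    exact ⟨M, hM.trans hprop.le, hM'⟩

lemma card_inter_vadd_vadd_le_one {X : Finset (ZMod q)}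
    (hX : ∀ g : ZMod q, g ≠ 0 → (X ∩ (g +ᵥ X)).card ≤ 1) {a b : ZMod q} (hab : a ≠ b) :
    ((a +ᵥ X) ∩ (b +ᵥ X)).card ≤ 1 := by
  have h := hX (b - a) (sub_ne_zero.2 hab.symm)
  rw [← Finset.card_vadd_finset a (X ∩ _), Finset.vadd_finset_inter, vadd_vadd,
    add_sub_cancel] at h
  exact h

lemma two_mul_card_le_of_card_inter_vadd_le_one {X Y : Finset (ZMod q)}
    (hX : ∀ g : ZMod q, g ≠ 0 → (X ∩ (g +ᵥ X)).card ≤ 1) (hY : 2 ≤ Y.card) :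
    2 * X.card ≤ (Y + X).card + 1 := by
  obtain ⟨a, ha, b, hb, hab⟩ := Finset.one_lt_card.1 hY
  have h := Finset.card_union_add_card_inter (a +ᵥ X) (b +ᵥ X)
  have h1 := card_inter_vadd_vadd_le_one hX hab
  have h2 : ((a +ᵥ X) ∪ (b +ᵥ X)).card ≤ (Y + X).card :=
    Finset.card_le_card (Finset.union_subset (Finset.vadd_finset_subset_add ha)
      (Finset.vadd_finset_subset_add hb))
  simp only [Finset.card_vadd_finset] at h
  omega

lemma three_mul_card_le_of_card_inter_vadd_le_one {X Y : Finset (ZMod q)}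
    (hX : ∀ g : ZMod q, g ≠ 0 → (X ∩ (g +ᵥ X)).card ≤ 1) (hY : 3 ≤ Y.card) :
    3 * X.card ≤ (Y + X).card + 3 := by
  obtain ⟨a, b, c, ha, hb, hc, hab, hac, hbc⟩ := Finset.two_lt_card_iff.1 hY
  have h := Finset.card_union_add_card_inter (a +ᵥ X) (b +ᵥ X)
  have h' := Finset.card_union_add_card_inter ((a +ᵥ X) ∪ (b +ᵥ X)) (c +ᵥ X)
  have h1 := card_inter_vadd_vadd_le_one hX hab
  have h2 := card_inter_vadd_vadd_le_one hX hac
  have h3 := card_inter_vadd_vadd_le_one hX hbc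
  have h4 : (((a +ᵥ X) ∪ (b +ᵥ X)) ∪ (c +ᵥ X)).card ≤ (Y + X).card :=
    Finset.card_le_card (Finset.union_subset (Finset.union_subset
      (Finset.vadd_finset_subset_add ha) (Finset.vadd_finset_subset_add hb))
      (Finset.vadd_finset_subset_add hc))
  have h5 := Finset.card_union_le ((a +ᵥ X) ∩ (c +ᵥ X)) ((b +ᵥ X) ∩ (c +ᵥ X))
  rw [← Finset.union_inter_distrib_right] at h5
  simp only [Finset.card_vadd_finset] at h h'
  omega

/-- A set which grows by at most one element when a two-element set is added to it is an arithmetic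
progression. -/
lemma eq_image_range_of_card_pair_add_le {S M : Finset (ZMod q)} (hM : M.card = 2)
    (hMS : (M + S).card ≤ S.card + 1) (hSq : S.card < q) :
    ∃ x d : ZMod q, S = (Finset.range S.card).image fun j : ℕ => x + j * d := by
  obtain ⟨a, b, hab, rfl⟩ := Finset.card_eq_two.1 hM
  set d := b - a with hd
  have hd0 : d ≠ 0 := sub_ne_zero.2 hab.symm
  have hshift : (({a, b} : Finset (ZMod q)) + S) = a +ᵥ (S ∪ (d +ᵥ S)) := by
    rw [Finset.vadd_finset_union, vadd_vadd, hd, add_sub_cancel, Finset.insert_eq,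
      Finset.union_add, Finset.singleton_add, Finset.singleton_add]
  rw [hshift, Finset.card_vadd_finset] at hMS
  have hone : (S \ (d +ᵥ S)).card ≤ 1 := by
    have h := Finset.card_sdiff_add_card S (d +ᵥ S)
    rw [Finset.card_vadd_finset] at h
    omega
  obtain ⟨x, hx⟩ : ∃ x, S \ (d +ᵥ S) ⊆ {x} := by
    rcases Finset.eq_empty_or_nonempty (S \ (d +ᵥ S)) with h | ⟨x, hx⟩
    · exact ⟨0, by simp [h]⟩
    · exact ⟨x, fun y hy => Finset.mem_singleton.2 (Finset.card_le_one.1 hone y hy x hx)⟩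
  have hback : ∀ y ∈ S, y ≠ x → y - d ∈ S := by
    intro y hy hyx
    by_contra hcon
    refine hyx (Finset.mem_singleton.1 (hx (Finset.mem_sdiff.2 ⟨hy, fun hmem => hcon ?_⟩)))
    obtain ⟨z, hz, hzy⟩ := Finset.mem_vadd_finset.1 hmem
    rw [← hzy, vadd_eq_add, add_sub_cancel_left]
    exact hz
  refine ⟨x, d, Finset.eq_of_subset_of_card_le ?_
    (Finset.card_image_le.trans (Finset.card_range _).le)⟩
  intro y hy
  by_contra hcon
  -- Walking backwards from `y` in steps of `d` never leaves `S`, which gives too many elements.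
  have hwalk : ∀ j : ℕ, j ≤ S.card → y - j * d ∈ S := by
    intro j
    induction j with
    | zero => intro _; simpa using hy
    | succ j ih =>
      intro hj
      have h1 := hback _ (ih (by omega)) fun hyx => hcon <| Finset.mem_image.2
        ⟨j, Finset.mem_range.2 (by omega), by rw [← hyx]; ring⟩
      convert h1 using 1
      push_cast
      ring
  have hcard : (Finset.range (S.card + 1)).card ≤ S.card := by
    refine Finset.card_le_card_of_injOn (fun j : ℕ => y - j * d) ?_ ?_
    · intro j hj
      exact hwalk j (by simpa [Nat.lt_succ_iff] using hj)
    · intro i hi j hj hij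
      have hi' := Finset.mem_range.1 (Finset.mem_coe.1 hi)
      have hj' := Finset.mem_range.1 (Finset.mem_coe.1 hj)
      exact ZMod.injOn_natCast_mul hd0 (show i < q by omega) (show j < q by omega)
        (sub_right_injective hij)
  rw [Finset.card_range] at hcard
  omega

/-- A case of Vosper's theorem. A minimal fragment `M` of `S` has two elements, which makes `S` a
progression: otherwise `S` is in turn a fragment of `M`, and a minimal fragment `N` of `M` has, just
as `M`, almost disjoint translates, which makes `N + M` too large. -/
theorem eq_image_range_of_card_add_self_le {S : Finset (ZMod q)} (hS : IsFragment S S)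
    (hSq : 3 * S.card ≤ q + 3) :
    ∃ x d : ZMod q, S = (Finset.range S.card).image fun j : ℕ => x + j * d := by
  have hSne : S.Nonempty := Finset.card_pos.1 (by have := hS.1; omega)
  obtain ⟨M, hMS, ⟨hM2, hMc, hMq⟩, hM⟩ :=
    exists_isFragment_card_inter_vadd_le_one hSne _ S rfl hS (by omega)
  rcases hM2.eq_or_lt with hM2 | hM3
  · exact eq_image_range_of_card_pair_add_le hM2.symm (by omega)
      (by have := Finset.card_le_card_add_right (s := S) hSne; have := hS.2.2; omega)
  exfalso
  have hMne : M.Nonempty := Finset.card_pos.1 (by omega)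
  rw [add_comm M S] at hMc hMq
  obtain ⟨N, hNS, ⟨hN2, hNc, hNq⟩, hN⟩ :=
    exists_isFragment_card_inter_vadd_le_one hMne _ S rfl ⟨hS.1, by omega, hMq⟩ (by omega)
  rcases hN2.eq_or_lt with hN2 | hN3
  · have := two_mul_card_le_of_card_inter_vadd_le_one hM hN2.le
    omega
  · have h1 := three_mul_card_le_of_card_inter_vadd_le_one hM hN3
    have h2 := three_mul_card_le_of_card_inter_vadd_le_one hN hM3
    rw [add_comm M N] at h2
    omega

end CriticalPairs

/-! ### The largest sum-free subsets of `ZMod (3 * q)` -/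

section LargestSumFree

open scoped Pointwise

variable {q : ℕ} [Fact q.Prime]

lemma card_add_card_add_card_le_of_disjoint {X Y Z : Finset (ZMod q)} (hX : X.Nonempty)
    (hY : Y.Nonempty) (hZ : Z.Nonempty) (h : Disjoint (X + Y) Z) :
    X.card + Y.card + Z.card ≤ q + 1 := by
  have hcd := ZMod.cauchy_davenport (Fact.out : q.Prime) hX hY
  have hle := Finset.card_le_univ ((X + Y) ∪ Z)
  rw [Finset.card_union_of_disjoint h, ZMod.card] at hle
  have := Finset.card_pos.2 hX
  have := Finset.card_pos.2 hZ
  rw [min_le_iff] at hcd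
  omega

/-- The arithmetic progression in `ZMod q` with start `x`, difference `d` and `m` terms. -/
def arithProg (q m : ℕ) (x d : ZMod q) : Finset (ZMod q) :=
  (Finset.range m).image fun j : ℕ => x + j * d

/-- The sizes force `(P, P)` to be a critical pair, and `A₀` and `Q` to be as large as the
disjointness conditions permit; hence all three sets are determined by the progression `P`. -/
lemma exists_arithProg_of_disjoint {k : ℕ} (hk : 2 ≤ k) (hq : q = 3 * k + 1)
    {A₀ P Q : Finset (ZMod q)} (h0 : A₀.card = k) (hP : P.card = k + 1) (hQ : Q.card = k)
    (hPQ : Disjoint (P + P) Q) (h0P : Disjoint (A₀ + P) P) :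
    ∃ x d : ZMod q, P = arithProg q (k + 1) x d ∧ A₀ = (P - P)ᶜ ∧ Q = (P + P)ᶜ := by
  have hPne : P.Nonempty := Finset.card_pos.1 (by omega)
  have hle := Finset.card_le_univ ((P + P) ∪ Q)
  rw [Finset.card_union_of_disjoint hPQ, ZMod.card] at hle
  have hcd := ZMod.cauchy_davenport (Fact.out : q.Prime) hPne hPne
  have hcd' := ZMod.cauchy_davenport (Fact.out : q.Prime) hPne hPne.neg
  rw [min_le_iff] at hcd hcd'
  rw [Finset.card_neg, ← sub_eq_add_neg] at hcd'
  -- `|P + P| + 2 ≤ q` is where `2 ≤ k` is needed: `2 k + 3 ≤ 3 k + 1`.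
  obtain ⟨x, d, hxd⟩ := eq_image_range_of_card_add_self_le (S := P)
    ⟨by omega, by omega, by omega⟩ (by omega)
  refine ⟨x, d, by rw [arithProg, ← hP]; exact hxd, ?_, ?_⟩
  · refine Finset.eq_of_subset_of_card_le (fun a ha => ?_) ?_
    · rw [Finset.mem_compl]
      intro hmem
      obtain ⟨y, hy, z, hz, hyz⟩ := Finset.mem_sub.1 hmem
      refine Finset.disjoint_left.1 h0P (Finset.add_mem_add ha hz) ?_
      rw [← hyz, sub_add_cancel]
      exact hy
    · rw [Finset.card_compl, ZMod.card]
      omega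
  · refine Finset.eq_of_subset_of_card_le (fun a ha => ?_) ?_
    · rw [Finset.mem_compl]
      exact fun hmem => Finset.disjoint_left.1 hPQ hmem ha
    · rw [Finset.card_compl, ZMod.card]
      omega

/-- The possible shapes of a largest sum-free subset of `ZMod 3 × ZMod q`, given by its slices over
`0`, `1` and `2`: two cosets of `ZMod q`, and two families indexed by arithmetic progressions. -/
def sumFreeShapes (q k : ℕ) [NeZero q] :
    Finset (Finset (ZMod q) × Finset (ZMod q) × Finset (ZMod q)) :=
  {(∅, Finset.univ, ∅), (∅, ∅, Finset.univ)} ∪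
    ((Finset.univ : Finset (ZMod q × ZMod q)).image fun y =>
      let P := arithProg q (k + 1) y.1 y.2
      ((P - P)ᶜ, P, (P + P)ᶜ)) ∪
    ((Finset.univ : Finset (ZMod q × ZMod q)).image fun y =>
      let P := arithProg q (k + 1) y.1 y.2
      ((P - P)ᶜ, (P + P)ᶜ, P))

lemma card_sumFreeShapes_le (q k : ℕ) [NeZero q] : (sumFreeShapes q k).card ≤ 2 * q ^ 2 + 2 := by
  have h : (Finset.univ : Finset (ZMod q × ZMod q)).card = q ^ 2 := by
    rw [Finset.card_univ, Fintype.card_prod, ZMod.card, sq]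
  unfold sumFreeShapes
  refine (Finset.card_union_le _ _).trans ?_
  refine (Nat.add_le_add (Finset.card_union_le _ _) le_rfl).trans ?_
  have h1 := Finset.card_le_two (a := ((∅ : Finset (ZMod q)), (Finset.univ : Finset (ZMod q)),
    (∅ : Finset (ZMod q)))) (b := (∅, ∅, Finset.univ))
  have h2 := fun f : ZMod q × ZMod q → Finset (ZMod q) × Finset (ZMod q) × Finset (ZMod q) =>
    (Finset.card_image_le (s := Finset.univ) (f := f)).trans h.le
  refine (Nat.add_le_add (Nat.add_le_add h1 (h2 _)) (h2 _)).trans (by omega)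

/-- A sum-free subset of `ZMod 3 × ZMod q` with at least `q` elements, given by its slices, has
exactly `q` elements and one of the known shapes. -/
lemma slices_mem_sumFreeShapes {k : ℕ} (hk : 2 ≤ k) (hq : q = 3 * k + 1)
    {A₀ A₁ A₂ : Finset (ZMod q)} (h00 : Disjoint (A₀ + A₀) A₀) (h01 : Disjoint (A₀ + A₁) A₁)
    (h02 : Disjoint (A₀ + A₂) A₂) (h11 : Disjoint (A₁ + A₁) A₂) (h22 : Disjoint (A₂ + A₂) A₁)
    (h12 : Disjoint (A₁ + A₂) A₀) (hcard : q ≤ A₀.card + A₁.card + A₂.card) :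
    A₀.card + A₁.card + A₂.card = q ∧ (A₀, A₁, A₂) ∈ sumFreeShapes q k := by
  have hle : ∀ X : Finset (ZMod q), X.card ≤ q := fun X => by
    simpa [ZMod.card] using Finset.card_le_univ X
  have huniv : ∀ X : Finset (ZMod q), q ≤ X.card → X = Finset.univ := fun X hX =>
    Finset.eq_univ_of_card X (by rw [ZMod.card]; exact le_antisymm (hle X) hX)
  rcases Finset.eq_empty_or_nonempty A₀ with rfl | hA0
  · rcases Finset.eq_empty_or_nonempty A₁ with rfl | hA1
    · simp only [Finset.card_empty, zero_add] at hcard ⊢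
      exact ⟨le_antisymm (hle _) hcard, by simp [sumFreeShapes, huniv _ hcard]⟩
    rcases Finset.eq_empty_or_nonempty A₂ with rfl | hA2
    · simp only [Finset.card_empty, zero_add, add_zero] at hcard ⊢
      exact ⟨le_antisymm (hle _) hcard, by simp [sumFreeShapes, huniv _ hcard]⟩
    have h1 := card_add_card_add_card_le_of_disjoint hA1 hA1 hA2 h11
    have h2 := card_add_card_add_card_le_of_disjoint hA2 hA2 hA1 h22
    simp only [Finset.card_empty, zero_add] at hcard
    omega
  have h0 := card_add_card_add_card_le_of_disjoint hA0 hA0 hA0 h00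
  have hA1 : A₁.Nonempty := by
    by_contra hne
    rw [Finset.not_nonempty_iff_eq_empty] at hne
    subst hne
    simp only [Finset.card_empty, add_zero] at hcard
    have h2 := card_add_card_add_card_le_of_disjoint hA0 (Y := A₂) (Z := A₂)
      (Finset.card_pos.1 (by omega)) (Finset.card_pos.1 (by omega)) h02
    omega
  have hA2 : A₂.Nonempty := by
    by_contra hne
    rw [Finset.not_nonempty_iff_eq_empty] at hne
    subst hne
    simp only [Finset.card_empty, add_zero] at hcard
    have h2 := card_add_card_add_card_le_of_disjoint hA0 hA1 hA1 h01
    omega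
  have h1 := card_add_card_add_card_le_of_disjoint hA1 hA1 hA2 h11
  have h2 := card_add_card_add_card_le_of_disjoint hA2 hA2 hA1 h22
  have h3 := card_add_card_add_card_le_of_disjoint hA0 hA1 hA1 h01
  have h4 := card_add_card_add_card_le_of_disjoint hA0 hA2 hA2 h02
  refine ⟨by omega, ?_⟩
  have hor : A₁.card = k + 1 ∧ A₂.card = k ∨ A₂.card = k + 1 ∧ A₁.card = k := by omega
  rcases hor with ⟨hc1, hc2⟩ | ⟨hc2, hc1⟩
  · obtain ⟨x, d, hP, h0', hQ⟩ :=
      exists_arithProg_of_disjoint hk hq (by omega) hc1 hc2 h11 h01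
    refine Finset.mem_union_left _ (Finset.mem_union_right _ (Finset.mem_image.2
      ⟨(x, d), Finset.mem_univ _, ?_⟩))
    simp only [← hP, ← h0', ← hQ]
  · obtain ⟨x, d, hP, h0', hQ⟩ :=
      exists_arithProg_of_disjoint hk hq (by omega) hc2 hc1 h22 h02
    refine Finset.mem_union_right _ (Finset.mem_image.2 ⟨(x, d), Finset.mem_univ _, ?_⟩)
    simp only [← hP, ← h0', ← hQ]

/-- The part of `A ⊆ ZMod (3 * q)` that is congruent to `i` modulo `3`, read modulo `q`. -/
noncomputable def slice (h : Nat.Coprime 3 q) (A : Set (ZMod (3 * q))) (i : ZMod 3) :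
    Finset (ZMod q) :=
  open Classical in Finset.univ.filter fun x => (ZMod.chineseRemainder h).symm (i, x) ∈ A

lemma mem_slice {h : Nat.Coprime 3 q} {A : Set (ZMod (3 * q))} {i : ZMod 3} {x : ZMod q} :
    x ∈ slice h A i ↔ (ZMod.chineseRemainder h).symm (i, x) ∈ A := by
  simp [slice]

lemma ncard_eq_sum_card_slice (h : Nat.Coprime 3 q) (A : Set (ZMod (3 * q))) :
    A.ncard = (slice h A 0).card + (slice h A 1).card + (slice h A 2).card := by
  classical
  have h1 : A.ncard = ((ZMod.chineseRemainder h).symm ⁻¹' A).ncard :=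
    (Set.ncard_preimage_of_injective_subset_range (ZMod.chineseRemainder h).symm.injective
      (by simp [(ZMod.chineseRemainder h).symm.surjective.range_eq])).symm
  have h2 : ((ZMod.chineseRemainder h).symm ⁻¹' A) =
      (Finset.univ.filter fun y => (ZMod.chineseRemainder h).symm y ∈ A :
        Finset (ZMod 3 × ZMod q)) := by
    ext y; simp
  rw [h1, h2, Set.ncard_coe_finset, Finset.card_filter, Fintype.sum_prod_type]
  simp only [← Finset.card_filter]
  exact Fin.sum_univ_three (fun i : ZMod 3 =>
    (Finset.univ.filter fun x : ZMod q => (ZMod.chineseRemainder h).symm (i, x) ∈ A).card)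

lemma IsSumFree.disjoint_slice {h : Nat.Coprime 3 q} {A : Set (ZMod (3 * q))} (hA : IsSumFree A)
    {i j l : ZMod 3} (hl : i + j = l) :
    Disjoint (slice h A i + slice h A j) (slice h A l) := by
  rw [Finset.disjoint_left]
  intro z hz
  obtain ⟨x, hx, y, hy, rfl⟩ := Finset.mem_add.1 hz
  rw [mem_slice] at hx hy ⊢
  have := hA _ hx _ hy
  rwa [← map_add, Prod.mk_add_mk, hl] at this

lemma slice_injective (h : Nat.Coprime 3 q) :
    Function.Injective fun A : Set (ZMod (3 * q)) => (slice h A 0, slice h A 1, slice h A 2) := by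
  intro A B hAB
  simp only [Prod.mk.injEq] at hAB
  have hall : ∀ i : ZMod 3, slice h A i = slice h B i := by
    intro i
    fin_cases i
    exacts [hAB.1, hAB.2.1, hAB.2.2]
  ext x
  have hx := Finset.ext_iff.1 (hall (ZMod.chineseRemainder h x).1) (ZMod.chineseRemainder h x).2
  simpa only [mem_slice, Prod.mk.eta, RingEquiv.symm_apply_apply] using hx

lemma le_ncard_of_mem_SF_univ (h : Nat.Coprime 3 q) {A : Set (ZMod (3 * q))}
    (hA : A ∈ SF (Set.univ : Set (ZMod (3 * q)))) : q ≤ A.ncard := by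
  set C : Set (ZMod (3 * q)) := {x | (ZMod.chineseRemainder h x).1 = 1} with hC
  have hCfree : IsSumFree C := by
    intro x hx y hy hxy
    simp only [hC, Set.mem_ofPred_eq, map_add, Prod.fst_add] at hx hy hxy
    rw [hx, hy] at hxy
    exact absurd hxy (by decide)
  have hle := hA.2 C (Set.subset_univ _) hCfree
  have hslice : slice h C 1 = Finset.univ := by
    ext x
    simp [mem_slice, hC]
  have hcard := ncard_eq_sum_card_slice h C
  rw [hslice, Finset.card_univ, ZMod.card] at hcard
  rw [← Set.Finite.cast_ncard_eq C.toFinite, ← Set.Finite.cast_ncard_eq A.toFinite,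
    Nat.cast_le] at hle
  omega

/-- The largest sum-free subsets of `ZMod (3 * q)` have `q` elements and one of the known shapes. -/
theorem ncard_eq_and_slices_mem_of_mem_SF_univ (h : Nat.Coprime 3 q) {k : ℕ} (hk : 2 ≤ k)
    (hq : q = 3 * k + 1) {A : Set (ZMod (3 * q))}
    (hA : A ∈ SF (Set.univ : Set (ZMod (3 * q)))) :
    A.ncard = q ∧ (slice h A 0, slice h A 1, slice h A 2) ∈ sumFreeShapes q k := by
  have hfree := hA.1.2
  rw [ncard_eq_sum_card_slice h]
  refine slices_mem_sumFreeShapes hk hq (hfree.disjoint_slice (by decide))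
    (hfree.disjoint_slice (by decide)) (hfree.disjoint_slice (by decide))
    (hfree.disjoint_slice (by decide)) (hfree.disjoint_slice (by decide))
    (hfree.disjoint_slice (by decide)) ?_
  rw [← ncard_eq_sum_card_slice h]
  exact le_ncard_of_mem_SF_univ h hA

/-- There are only polynomially many largest sum-free subsets of `ZMod (3 * q)`. -/
theorem ncard_SF_univ_le (h : Nat.Coprime 3 q) {k : ℕ} (hk : 2 ≤ k) (hq : q = 3 * k + 1) :
    (SF (Set.univ : Set (ZMod (3 * q)))).ncard ≤ 2 * q ^ 2 + 2 := by
  refine le_trans ?_ (card_sumFreeShapes_le q k)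
  rw [← Set.ncard_coe_finset]
  exact Set.ncard_le_ncard_of_injOn _
    (fun A hA => (ncard_eq_and_slices_mem_of_mem_SF_univ h hk hq hA).2)
    (slice_injective h).injOn

end LargestSumFree

/-! ### A slightly too long interval -/

section LongInterval

variable {q a : ℕ} [NeZero q]

/-- The residues in `ZMod n` whose least representative lies in `[u, v)`. -/
def valIco (n : ℕ) [NeZero n] (u v : ℕ) : Finset (ZMod n) :=
  Finset.univ.filter fun x => u ≤ x.val ∧ x.val < v

lemma mem_valIco {n : ℕ} [NeZero n] {u v : ℕ} {x : ZMod n} :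
    x ∈ valIco n u v ↔ u ≤ x.val ∧ x.val < v := by
  simp [valIco]

lemma card_valIco {n : ℕ} [NeZero n] {u v : ℕ} (hv : v ≤ n) : (valIco n u v).card = v - u := by
  rw [← Nat.card_Ico, ← Finset.card_image_of_injective (valIco n u v) (ZMod.val_injective n)]
  congr 1
  ext m
  simp only [Finset.mem_image, mem_valIco, Finset.mem_Ico]
  constructor
  · rintro ⟨x, hx, rfl⟩
    exact hx
  · intro hm
    have hval : ((m : ZMod n)).val = m := ZMod.val_cast_of_lt (by omega)
    exact ⟨m, by rwa [hval], hval⟩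

/-- The interval `[q - a, 2 q)`, which for `a = 0` is a largest sum-free subset of
`ZMod (3 * q)`. -/
abbrev longInterval (q a : ℕ) [NeZero q] : Finset (ZMod (3 * q)) := valIco (3 * q) (q - a) (2 * q)

lemma card_longInterval (ha : a ≤ q) : (longInterval q a).card = q + a := by
  rw [card_valIco (by omega)]
  omega

/-- The pairs of elements of the interval whose sum lies in the interval, too. -/
def longIntervalSums (q a : ℕ) [NeZero q] : Finset (ZMod (3 * q) × ZMod (3 * q)) :=
  (longInterval q a ×ˢ longInterval q a).filter fun z => z.1 + z.2 ∈ longInterval q a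

/-- The part of the interval, close to its ends, that contains the summands of all sums within
the interval. -/
def longIntervalEnds (q a : ℕ) [NeZero q] : Finset (ZMod (3 * q)) :=
  valIco (3 * q) (q - a) (q + a) ∪ valIco (3 * q) (2 * q - a) (2 * q)

lemma card_longIntervalEnds_le (ha : a ≤ q) : (longIntervalEnds q a).card ≤ 3 * a := by
  refine (Finset.card_union_le _ _).trans ?_
  rw [card_valIco (by omega), card_valIco (by omega)]
  omega

lemma longIntervalSums_subset (ha : 2 * a < q) :
    longIntervalSums q a ⊆ longIntervalEnds q a ×ˢ longIntervalEnds q a := by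
  rintro ⟨x, y⟩ h
  simp only [longIntervalSums, longIntervalEnds, longInterval, Finset.mem_filter,
    Finset.mem_product, mem_valIco, Finset.mem_union] at h ⊢
  obtain ⟨⟨hx, hy⟩, hxy⟩ := h
  have hadd := ZMod.val_add x y
  rcases lt_or_ge (x.val + y.val) (3 * q) with hlt | hge
  · rw [Nat.mod_eq_of_lt hlt] at hadd
    omega
  · rw [Nat.mod_eq_sub_mod hge, Nat.mod_eq_of_lt (by omega)] at hadd
    omega

lemma sum_pow_card_longIntervalSums_le (ha : 2 * a < q) {p : ℝ} (h0 : 0 ≤ p) :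
    ∑ z ∈ longIntervalSums q a, p ^ ({z.1, z.2, z.1 + z.2} : Finset (ZMod (3 * q))).card ≤
      9 * a ^ 2 * p ^ 3 + 3 * a * p ^ 2 := by
  -- Without `0` in the interval, `x + y` differs from `x` and `y`: only `x = y` can coincide.
  have hne : ∀ x ∈ longInterval q a, x ≠ 0 := by
    rintro x hx rfl
    rw [mem_valIco, ZMod.val_zero] at hx
    omega
  set W := longIntervalEnds q a
  have hW : (W.card : ℝ) ≤ 3 * a := by
    exact_mod_cast card_longIntervalEnds_le (show a ≤ q by omega)
  have hterm : ∀ z ∈ longIntervalSums q a,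
      p ^ ({z.1, z.2, z.1 + z.2} : Finset (ZMod (3 * q))).card ≤
        p ^ 3 + if z.1 = z.2 then p ^ 2 else 0 := by
    rintro ⟨x, y⟩ hz
    simp only [longIntervalSums, Finset.mem_filter, Finset.mem_product] at hz
    have hx : x ≠ x + y := fun h => hne y hz.1.2 (by simpa using h.symm)
    have hy : y ≠ x + y := fun h => hne x hz.1.1 (by simpa using h.symm)
    by_cases hxy : x = y
    · subst hxy
      have : (({x, x, x + x} : Finset (ZMod (3 * q)))).card = 2 := by
        rw [Finset.insert_eq_of_mem (Finset.mem_insert_self _ _), Finset.card_pair hx]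
      simp only [this, if_true]
      have := pow_nonneg h0 3
      linarith
    · rw [Finset.card_eq_three.2 ⟨x, y, x + y, hxy, hx, hy, rfl⟩]
      simp [hxy]
  calc ∑ z ∈ longIntervalSums q a, p ^ ({z.1, z.2, z.1 + z.2} : Finset (ZMod (3 * q))).card
      ≤ ∑ z ∈ longIntervalSums q a, (p ^ 3 + if z.1 = z.2 then p ^ 2 else 0) :=
        Finset.sum_le_sum hterm
    _ ≤ ∑ z ∈ W ×ˢ W, (p ^ 3 + if z.1 = z.2 then p ^ 2 else 0) :=
        Finset.sum_le_sum_of_subset_of_nonneg (longIntervalSums_subset ha) fun z _ _ => by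
          split_ifs <;> positivity
    _ = (W.card : ℝ) ^ 2 * p ^ 3 + W.card * p ^ 2 := by
        rw [Finset.sum_add_distrib, Finset.sum_const, Finset.card_product, Finset.sum_product]
        congr 1
        · rw [nsmul_eq_mul]; push_cast; ring
        · rw [Finset.sum_congr rfl (g := fun _ => p ^ 2), Finset.sum_const, nsmul_eq_mul]
          intro x hx
          simp [hx]
    _ ≤ (3 * a) ^ 2 * p ^ 3 + 3 * a * p ^ 2 := by gcongr
    _ = 9 * a ^ 2 * p ^ 3 + 3 * a * p ^ 2 := by ring

/-- Removing one element for each sum within the interval leaves a sum-free set. -/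
lemma exists_isSumFree_subset_longInterval (B : Set (ZMod (3 * q))) :
    ∃ S : Set (ZMod (3 * q)), S ⊆ B ∧ IsSumFree S ∧
      ((longInterval q a : Set (ZMod (3 * q))) ∩ B).ncard ≤ S.ncard +
        {z ∈ (longIntervalSums q a : Set (ZMod (3 * q) × ZMod (3 * q))) |
          (({z.1, z.2, z.1 + z.2} : Finset (ZMod (3 * q))) : Set (ZMod (3 * q))) ⊆ B}.ncard := by
  set J : Set (ZMod (3 * q)) := (longInterval q a : Set (ZMod (3 * q)))
  set T := {z ∈ (longIntervalSums q a : Set (ZMod (3 * q) × ZMod (3 * q))) |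
          (({z.1, z.2, z.1 + z.2} : Finset (ZMod (3 * q))) : Set (ZMod (3 * q))) ⊆ B} with hT
  refine ⟨(J ∩ B) \ ((fun z => z.1 + z.2) '' T), fun x hx => hx.1.2, ?_, ?_⟩
  · rintro x ⟨⟨hxJ, hxB⟩, -⟩ y ⟨⟨hyJ, hyB⟩, -⟩ ⟨⟨hJ, hB⟩, hnot⟩
    refine hnot ⟨(x, y), ⟨?_, ?_⟩, rfl⟩
    · simp only [longIntervalSums, Finset.coe_filter, Finset.mem_product, Set.mem_ofPred_eq]
      exact ⟨⟨hxJ, hyJ⟩, hJ⟩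
    · intro z hz
      simp only [Finset.coe_insert, Finset.coe_singleton, Set.mem_insert_iff,
        Set.mem_singleton_iff] at hz
      rcases hz with rfl | rfl | rfl
      exacts [hxB, hyB, hB]
  · have h1 := Set.ncard_le_ncard_sdiff_add_ncard (J ∩ B) ((fun z => z.1 + z.2) '' T)
      (Set.toFinite _)
    have h2 := Set.ncard_image_le (f := fun z : ZMod (3 * q) × ZMod (3 * q) => z.1 + z.2)
      (Set.toFinite T)
    omega

end LongInterval

/-! ### Comparison of the interval with the largest sum-free sets -/

section Comparison

/-- The event that some sum-free subset of the random set `B` has more elements than `A ∩ B` for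
every largest sum-free set `A`. -/
def beatsLargestSumFree (n : ℕ) : Set (Set (ZMod n)) :=
  {B | ∃ S : Set (ZMod n), S ⊆ B ∧ IsSumFree S ∧
    ∀ A ∈ SF (Set.univ : Set (ZMod n)), (A ∩ B).encard < S.encard}

lemma beatsLargestSumFree_subset (n : ℕ) [NeZero n] :
    beatsLargestSumFree n ⊆ {B | ¬ IsSumFreeGood B} := by
  rintro B ⟨S, hSB, hS, hlt⟩ hgood
  obtain ⟨M, hM, hmax⟩ := Set.exists_max_image {X : Set (ZMod n) | X ⊆ B ∧ IsSumFree X} Set.encard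
    (Set.toFinite _) ⟨S, hSB, hS⟩
  obtain ⟨A, hA, hMA⟩ := hgood M ⟨hM, fun A' h1 h2 => hmax A' ⟨h1, h2⟩⟩
  have h1 := hmax S ⟨hSB, hS⟩
  rw [hMA, Set.inter_comm] at h1
  exact absurd (hlt A hA) (not_lt.2 h1)

/-- The lower bound on the probability in terms of the excess length `a` of the interval and a
common bound `t` for the fluctuations. The gain `a p` exceeds three times `t`: once for the
fluctuation of the largest sum-free sets, once for that of the interval, and once for the number of
sums within the interval. -/
lemma le_randomSubset_beatsLargestSumFree {q k a : ℕ} [Fact q.Prime] (h : Nat.Coprime 3 q)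
    (hk : 2 ≤ k) (hq : q = 3 * k + 1) (p : unitInterval) {t : ℝ} (ha : 2 * a < q) (hp : 0 < (p : ℝ))
    (ht0 : 0 < t) (hat : 3 * t ≤ a * p) (ht : t ≤ 2 * (p * q)) :
    1 - ((2 * q ^ 2 + 2) * Real.exp (-(t ^ 2 / (4 * (p * q)))) +
        Real.exp (-(t ^ 2 / (4 * (p * (q + a))))) + (9 * a ^ 2 * p ^ 3 + 3 * a * p ^ 2) / t) ≤
      (randomSubset (3 * q) p).real (beatsLargestSumFree (3 * q)) := by
  classical
  set μ := randomSubset (3 * q) p with hμ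
  have hμp : MeasureTheory.IsProbabilityMeasure μ := by rw [hμ, randomSubset]; infer_instance
  have hq0 : (0 : ℝ) < q := by exact_mod_cast (Fact.out : q.Prime).pos
  set F : Finset (Set (ZMod (3 * q))) := (SF (Set.univ : Set (ZMod (3 * q)))).toFinset with hF
  set E₂ : Set (Set (ZMod (3 * q))) := ⋃ A ∈ F, {B | (p : ℝ) * q + t ≤ ((A ∩ B).ncard : ℝ)} with hE₂
  set J := longInterval q a
  set E₃ : Set (Set (ZMod (3 * q))) :=
    {B | (((J : Set (ZMod (3 * q))) ∩ B).ncard : ℝ) ≤ p * J.card - t} with hE₃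
  set E₄ : Set (Set (ZMod (3 * q))) :=
    {B | t ≤ ({z ∈ (longIntervalSums q a : Set (ZMod (3 * q) × ZMod (3 * q))) |
          (({z.1, z.2, z.1 + z.2} : Finset (ZMod (3 * q))) : Set (ZMod (3 * q))) ⊆ B}.ncard : ℝ)}
    with hE₄
  have hJ : (J.card : ℝ) = q + a := by
    rw [card_longInterval (by omega)]
    push_cast
    rfl
  have hcover : Set.univ ⊆ beatsLargestSumFree (3 * q) ∪ (E₂ ∪ E₃ ∪ E₄) := by
    intro B _
    by_contra hB
    simp only [Set.mem_union, not_or] at hB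
    obtain ⟨hB1, ⟨hB2, hB3⟩, hB4⟩ := hB
    obtain ⟨S, hSB, hS, hcard⟩ := exists_isSumFree_subset_longInterval (a := a) B
    refine hB1 ⟨S, hSB, hS, fun A hA => ?_⟩
    simp only [hE₂, hF, Set.mem_iUnion, Set.mem_toFinset, not_exists, Set.mem_ofPred_eq,
      not_le] at hB2
    have hA2 := hB2 A hA
    simp only [hE₃, hE₄, Set.mem_ofPred_eq, not_le] at hB3 hB4
    have hcard' := Nat.cast_le (α := ℝ).2 hcard
    rw [← Set.Finite.cast_ncard_eq (Set.toFinite _), ← Set.Finite.cast_ncard_eq (Set.toFinite _),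
      Nat.cast_lt, ← Nat.cast_lt (α := ℝ)]
    rw [Nat.cast_add] at hcard'
    rw [hJ] at hB3
    linarith
  have h2 : μ.real E₂ ≤ (2 * q ^ 2 + 2) * Real.exp (-(t ^ 2 / (4 * (p * q)))) := by
    refine (MeasureTheory.measureReal_biUnion_finset_le _ _).trans ?_
    refine (Finset.sum_le_card_nsmul F _ (Real.exp (-(t ^ 2 / (4 * (p * q))))) ?_).trans ?_
    · intro A hA
      have hcard := (ncard_eq_and_slices_mem_of_mem_SF_univ h hk hq (Set.mem_toFinset.1 hA)).1
      rw [Set.ncard_eq_toFinset_card'] at hcard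
      have := setBernoulli_upper_tail p A.toFinset (m := q) (by exact_mod_cast hcard.le) ht0.le
        (by positivity) ht
      rw [Set.coe_toFinset] at this
      exact this
    · rw [nsmul_eq_mul]
      refine mul_le_mul_of_nonneg_right ?_ (Real.exp_nonneg _)
      have := ncard_SF_univ_le h hk hq
      rw [Set.ncard_eq_toFinset_card'] at this
      exact_mod_cast this
  have h3 : μ.real E₃ ≤ Real.exp (-(t ^ 2 / (4 * (p * (q + a))))) := by
    rw [← hJ]
    refine setBernoulli_lower_tail p J ht0.le (by rw [hJ]; positivity) ?_
    rw [hJ]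
    have : (0 : ℝ) ≤ p * a := by positivity
    nlinarith
  have h4 : μ.real E₄ ≤ (9 * a ^ 2 * p ^ 3 + 3 * a * p ^ 2) / t := by
    refine (setBernoulli_card_subset_ge_le p (longIntervalSums q a)
      (fun z => {z.1, z.2, z.1 + z.2}) ht0).trans ?_
    exact div_le_div_of_nonneg_right (sum_pow_card_longIntervalSums_le ha hp.le) ht0.le
  have huniv : (1 : ℝ) ≤ μ.real (beatsLargestSumFree (3 * q) ∪ (E₂ ∪ E₃ ∪ E₄)) := by
    rw [← MeasureTheory.probReal_univ (μ := μ)]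
    exact MeasureTheory.measureReal_mono hcover (MeasureTheory.measure_ne_top _ _)
  have hu1 := MeasureTheory.measureReal_union_le (μ := μ) (beatsLargestSumFree (3 * q))
    (E₂ ∪ E₃ ∪ E₄)
  have hu2 := MeasureTheory.measureReal_union_le (μ := μ) (E₂ ∪ E₃) E₄
  have hu3 := MeasureTheory.measureReal_union_le (μ := μ) E₂ E₃
  linarith

/-- The choice `t = 4 √(p q log n)`, which makes the exponentially small probabilities beat the
number of largest sum-free sets, together with `a ≈ 4 t / p`. -/
lemma le_randomSubset_beatsLargestSumFree_of_log_le {q k n : ℕ} [Fact q.Prime]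
    (h : Nat.Coprime 3 q) (hk : 2 ≤ k) (hq : q = 3 * k + 1) (hn : n = 3 * q) (p : unitInterval)
    (hlog : Real.log n / n ≤ 1 / 20000 * p) :
    1 - (4 / (n : ℝ) + 2400 * √(p ^ 3 * (n * Real.log n))) ≤
      (randomSubset n p).real (beatsLargestSumFree n) := by
  subst hn
  set L := Real.log ((3 * q : ℕ) : ℝ) with hL
  have hq7 : (7 : ℝ) ≤ q := by exact_mod_cast (by omega : 7 ≤ q)
  have hncast : ((3 * q : ℕ) : ℝ) = 3 * q := by push_cast; ring
  have hL1 : 1 ≤ L := by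
    rw [hL, Real.le_log_iff_exp_le (by rw [hncast]; linarith), hncast]
    have := Real.exp_one_lt_d9
    linarith
  rw [hncast] at hlog ⊢
  have hp1 : (p : ℝ) ≤ 1 := p.2.2
  have hLpq : 6000 * L ≤ p * q := by
    rw [div_le_iff₀ (by linarith)] at hlog
    linarith
  have hp0 : 0 < (p : ℝ) := by
    by_contra hcon
    nlinarith
  set t := 4 * √(p * q * L) with ht
  have hpqL : 0 < (p : ℝ) * q * L := by positivity
  have ht2 : t ^ 2 = 16 * (p * q * L) := by rw [ht, mul_pow, Real.sq_sqrt hpqL.le]; norm_num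
  have ht0 : 0 < t := by positivity
  have ht1 : 1 ≤ t := by nlinarith
  have htpq : 18 * t ≤ p * q := by
    refine (sq_le_sq₀ (by positivity) (by positivity)).1 ?_
    nlinarith
  set a := ⌈4 * t / p⌉₊ with ha
  have ha1 : 4 * t / p ≤ a := Nat.le_ceil _
  have ha2 : (a : ℝ) < 4 * t / p + 1 := Nat.ceil_lt_add_one (by positivity)
  rw [div_le_iff₀ hp0] at ha1
  have ha3 : (a : ℝ) * p ≤ 4 * t + p := by
    rw [div_add_one hp0.ne', lt_div_iff₀ hp0] at ha2
    exact ha2.le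
  have haq : 2 * a < q := by
    have : (2 * a : ℝ) < q := by
      refine lt_of_mul_lt_mul_right ?_ hp0.le
      nlinarith
    exact_mod_cast this
  have haq' : (a : ℝ) ≤ q := by exact_mod_cast (by omega : a ≤ q)
  refine le_trans ?_ (le_randomSubset_beatsLargestSumFree h hk hq p haq hp0 ht0 (by linarith)
    (by linarith))
  have hexp : Real.exp (-L) = 1 / (3 * q) := by
    rw [Real.exp_neg, hL, Real.exp_log (by rw [hncast]; linarith), hncast, one_div]
  -- Here `t ^ 2 / (4 p q)` is `4 log n`, so the exponential is `n⁻⁴`.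
  have hterm1 : (2 * q ^ 2 + 2) * Real.exp (-(t ^ 2 / (4 * (p * q)))) ≤ 3 / (3 * (q : ℝ)) := by
    have h1 : -(t ^ 2 / (4 * (p * q))) = (4 : ℕ) * (-L) := by
      rw [ht2]; push_cast; field_simp; norm_num
    rw [h1, Real.exp_nat_mul, hexp, one_div, inv_pow, ← div_eq_mul_inv, div_le_div_iff₀
      (by positivity) (by positivity)]
    nlinarith [pow_pos (by linarith : (0 : ℝ) < q) 3, pow_pos (by linarith : (0 : ℝ) < q) 4]
  -- The exponent is at least `2 log n`, since `a ≤ q`.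
  have hterm2 : Real.exp (-(t ^ 2 / (4 * (p * (q + a))))) ≤ 1 / (3 * q) := by
    rw [← hexp]
    apply Real.exp_le_exp.2
    rw [neg_le_neg_iff, le_div_iff₀ (by positivity), ht2]
    have := mul_le_mul_of_nonneg_left haq' (by positivity : (0 : ℝ) ≤ p * L)
    nlinarith
  have hterm3 : (9 * (a : ℝ) ^ 2 * p ^ 3 + 3 * a * p ^ 2) / t ≤ 2400 * √(p ^ 3 * (3 * q * L)) := by
    have hap : (a : ℝ) * p ≤ 5 * t := by linarith
    have hap0 : 0 ≤ a * (p : ℝ) := by positivity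
    have h1 : (9 * (a : ℝ) ^ 2 * p ^ 3 + 3 * a * p ^ 2) / t ≤ 240 * ((p : ℝ) * t) := by
      rw [div_le_iff₀ ht0]
      have e1 : ((a : ℝ) * p) ^ 2 ≤ (5 * t) ^ 2 := pow_le_pow_left₀ hap0 hap 2
      have e2 : ((a : ℝ) * p) ≤ 5 * t ^ 2 := by nlinarith
      have e3 := mul_le_mul_of_nonneg_left e1 hp0.le
      have e4 := mul_le_mul_of_nonneg_left e2 hp0.le
      nlinarith
    have h2 : (p : ℝ) * t ≤ 4 * √(p ^ 3 * (3 * q * L)) := by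
      have h3 : (p : ℝ) * t = 4 * √(p ^ 2 * (p * q * L)) := by
        rw [Real.sqrt_mul (by positivity), Real.sqrt_sq hp0.le, ht]
        ring
      rw [h3]
      refine mul_le_mul_of_nonneg_left (Real.sqrt_le_sqrt ?_) (by norm_num)
      nlinarith [mul_pos (pow_pos hp0 2) hpqL]
    linarith [Real.sqrt_nonneg (p ^ 3 * (3 * q * L))]
  have : 4 / (3 * (q : ℝ)) = 3 / (3 * q) + 1 / (3 * q) := by ring
  linarith

end Comparison

/-! ### The limit -/

lemma tendsto_pow_three_mul_log (p : ℕ → unitInterval)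
    (hupper : (fun n : ℕ => (p n : ℝ)) =o[threePrimeAtTop]
      (fun n : ℕ => (1 / ((n : ℝ) * Real.log (n : ℝ))) ^ (1 / 3 : ℝ))) :
    Tendsto (fun n : ℕ => (p n : ℝ) ^ 3 * (n * Real.log n)) threePrimeAtTop (𝓝 0) := by
  have h := hupper.tendsto_div_nhds_zero.pow 3
  rw [zero_pow three_ne_zero] at h
  refine h.congr fun n => ?_
  have h0 : (0 : ℝ) ≤ 1 / (n * Real.log n) := by
    have := Real.log_natCast_nonneg n
    positivity
  rw [div_pow, ← Real.rpow_natCast (_ ^ (1 / 3 : ℝ)), ← Real.rpow_mul h0, Nat.cast_ofNat,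
    one_div_mul_cancel three_ne_zero, Real.rpow_one, one_div, div_inv_eq_mul]

theorem mainTheorem4 (p : ℕ → unitInterval)
    (hlower : (fun n : ℕ => Real.log (n : ℝ) / (n : ℝ)) =o[threePrimeAtTop]
      (fun n : ℕ => (p n : ℝ)))
    (hupper : (fun n : ℕ => (p n : ℝ)) =o[threePrimeAtTop]
      (fun n : ℕ => (1 / ((n : ℝ) * Real.log (n : ℝ))) ^ (1 / 3 : ℝ))) :
    Tendsto (fun n : ℕ => (randomSubset n (p n)).real
        {B : Set (ZMod n) | ∃ S : Set (ZMod n), S ⊆ B ∧ IsSumFree S ∧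
          ∀ A ∈ SF (Set.univ : Set (ZMod n)), (A ∩ B).encard < S.encard})
      threePrimeAtTop (𝓝 1) ∧
    Tendsto (fun n : ℕ => (randomSubset n (p n)).real
        {B : Set (ZMod n) | ¬ IsSumFreeGood B})
      threePrimeAtTop (𝓝 1) := by
  have hatTop : threePrimeAtTop ≤ atTop := inf_le_left
  have hmem : ∀ᶠ n in threePrimeAtTop, ∃ q k : ℕ, q.Prime ∧ 2 ≤ k ∧ q = 3 * k + 1 ∧ n = 3 * q := by
    have h1 : ∀ᶠ n in threePrimeAtTop, ∃ q : ℕ, q.Prime ∧ q ≡ 1 [MOD 3] ∧ n = 3 * q :=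
      eventually_inf_principal.2 (Eventually.of_forall fun n hn => hn)
    filter_upwards [h1, hatTop (eventually_ge_atTop 21)] with n hn hn21
    obtain ⟨q, hq, hmod, rfl⟩ := hn
    have hmod' : q % 3 = 1 := hmod
    exact ⟨q, q / 3, hq, by omega, by omega, rfl⟩
  have hprob : ∀ n, MeasureTheory.IsProbabilityMeasure (randomSubset n (p n)) := fun n => by
    rw [randomSubset]; infer_instance
  have hlim : Tendsto (fun n : ℕ => 1 - (4 / (n : ℝ) +
      2400 * √((p n : ℝ) ^ 3 * (n * Real.log n)))) threePrimeAtTop (𝓝 1) := by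
    have h1 : Tendsto (fun n : ℕ => 4 / (n : ℝ)) threePrimeAtTop (𝓝 0) :=
      (tendsto_const_div_atTop_nhds_zero_nat 4).mono_left hatTop
    have h2 := ((tendsto_pow_three_mul_log p hupper).sqrt).const_mul 2400
    simpa using (h1.add h2).const_sub 1
  have hbound : ∀ᶠ n : ℕ in threePrimeAtTop, 1 - (4 / (n : ℝ) +
      2400 * √((p n : ℝ) ^ 3 * (n * Real.log n))) ≤
        (randomSubset n (p n)).real (beatsLargestSumFree n) := by
    filter_upwards [hmem, hlower.def (show (0 : ℝ) < 1 / 20000 by norm_num)] with n hn hlog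
    obtain ⟨q, k, hq, hk, hqk, hnq⟩ := hn
    have : Fact q.Prime := ⟨hq⟩
    have hcop : Nat.Coprime 3 q := (Nat.coprime_primes Nat.prime_three hq).2 (by omega)
    refine le_randomSubset_beatsLargestSumFree_of_log_le hcop hk hqk hnq (p n) ?_
    rw [Real.norm_eq_abs, Real.norm_eq_abs, abs_of_nonneg (p n).2.1] at hlog
    exact (le_abs_self _).trans hlog
  refine ⟨tendsto_of_tendsto_of_tendsto_of_le_of_le' hlim tendsto_const_nhds hbound
    (Eventually.of_forall fun n => MeasureTheory.measureReal_le_one),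
    tendsto_of_tendsto_of_tendsto_of_le_of_le' hlim tendsto_const_nhds ?_
    (Eventually.of_forall fun n => MeasureTheory.measureReal_le_one)⟩
  filter_upwards [hbound, hmem] with n hn hn'
  obtain ⟨q, k, hq, -, -, rfl⟩ := hn'
  have : NeZero q := ⟨hq.ne_zero⟩
  exact hn.trans (MeasureTheory.measureReal_mono (beatsLargestSumFree_subset _)
    (MeasureTheory.measure_ne_top _ _))
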